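/- A continuous-time Markov decision process (CTMDP) $\mathcal M=(L,\mathrm{Act},\mathbf R,\nu,B)$ consists of a finite set $L$ of locations, a finite set $\mathrm{Act}$ of actions, a rate matrix $\mathbf R:L\times \mathrm{Act}\times L\to\mathbb Q_{\ge 0}$, an initial distribution $\nu$ on $L$, and a goal region $B\subseteq L$. Put $\mathbf R(l,a,L)=\sum_{l'\in L}\mathbf R(l,a,l')$; the action $a$ is enabled in $l$ if $\mathbf R(l,a,L)>0$. Every location is required to have an enabled action, and $B$ is absorbing (no transition of positive rate leads from $B$ to $L\setminus B$). The exit rates $\mathbf R(l,a,L)$ need not be uniform. A randomised hop-counting (CR) scheduler $\mathcal S$ maps each pair $(l,n)\in L\times\mathbb N$ to a probability distribution on the actions enabled in $l$; a deterministic hop-counting (CD) scheduler maps each such pair to an action enabled in $l$, and is identified with the CR scheduler whose decisions are the corresponding point masses. A scheduler $\mathcal S$ and a start location $l_0$ induce a probability measure on infinite timed paths: in location $l_n$, reached after $n$ steps, an action $a_n$ is drawn from $\mathcal S(l_n,n)$, the sojourn time in $l_n$ is exponentially distributed with rate $\mathbf R(l_n,a_n,L)$, and, independently of it, the next location is $l'$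 with probability $\mathbf R(l_n,a_n,l')/\mathbf R(l_n,a_n,L)$. Let $\mathrm{Pr}_{\mathcal S}^{\mathcal M}(l,t)$ be the probability that a path started in $l$ enters $B$ at some time at most $t$ (a path that starts in $B$ enters it at time $0$), and let $\mathrm{Pr}_{\mathcal S}^{\mathcal M}(t)=\sum_{l\in L}\nu(l)\,\mathrm{Pr}_{\mathcal S}^{\mathcal M}(l,t)$. For a given $t$, a scheduler of a class is optimal for this class if it maximises $\mathrm{Pr}_{\mathcal S}^{\mathcal M}(t)$ over the class. Theorem. For every CTMDP $\mathcal M$ and every $t\ge 0$, every optimal CD scheduler is also an optimal CR scheduler. Moreover, optimal CD schedulers exist, and $$\max_{\mathcal S\in CD}\mathrm{Pr}_{\mathcal S}^{\mathcal M}(t)=\sup_{\mathcal S\in CR}\mathrm{Pr}_{\mathcal S}^{\mathcal M}(t)=\max_{\mathcal S\in CR}\mathrm{Pr}_{\mathcal S}^{\mathcal M}(t).$$ -/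

import Mathlib

open MeasureTheory ProbabilityTheory
open scoped NNReal ENNReal

/-- A continuous-time Markov decision process with finite location set `L` and finite action
set `A`. -/
structure CTMDP (L A : Type*) [Fintype L] [Fintype A] where
  /-- the rate matrix -/
  rate : L → A → L → ℚ≥0
  /-- the initial distribution -/
  init : PMF L
  /-- the goal region -/
  goal : Set L
  /-- every location has an action with positive total exit rate -/
  exists_enabled : ∀ l, ∃ a, 0 < ∑ l', rate l a l'
  /-- the goal region is absorbing: no transition leads out of it -/
  goal_absorbing : ∀ l ∈ goal, ∀ a, ∀ l', 0 < rate l a l' → l' ∈ goal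

namespace CTMDP

variable {L A : Type*} [Fintype L] [Fintype A]

/-- The total exit rate of location `l` under action `a`. -/
def exitRate (M : CTMDP L A) (l : L) (a : A) : ℚ≥0 := ∑ l', M.rate l a l'

/-- The actions enabled in location `l`. -/
def enabled (M : CTMDP L A) (l : L) : Set A := {a | 0 < M.exitRate l a}

/-- The time-abstract transition probability. -/
def transProb (M : CTMDP L A) (l : L) (a : A) (l' : L) : ℚ≥0 :=
  M.rate l a l' / M.exitRate l a

/-- Randomised hop-counting (CR) schedulers: a location and the number of steps taken so far are
mapped to a distribution over the enabled actions. -/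
structure CRScheduler (M : CTMDP L A) where
  decision : L → ℕ → PMF A
  enabled : ∀ l n, ∀ a ∈ (decision l n).support, a ∈ M.enabled l

/-- Deterministic hop-counting (CD) schedulers: a location and the number of steps taken so far are
mapped to an enabled action. -/
structure CDScheduler (M : CTMDP L A) where
  decision : L → ℕ → A
  enabled : ∀ l n, decision l n ∈ M.enabled l

/-- A deterministic scheduler, seen as a randomised one that takes point-mass decisions. -/
noncomputable def CDScheduler.toCR {M : CTMDP L A} (S : M.CDScheduler) : M.CRScheduler where
  decision l n := PMF.pure (S.decision l n)
  enabled l n a ha := by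
    rw [PMF.mem_support_pure_iff] at ha
    exact ha ▸ S.enabled l n

/-- One step of a timed path: the action taken, the sojourn time in the location that is left,
and the location that is entered. -/
abbrev Step (L A : Type*) : Type _ := A × ℝ × L

variable [MeasurableSpace L] [DiscreteMeasurableSpace L]
  [MeasurableSpace A] [DiscreteMeasurableSpace A]

/-- The law of the next step from location `l` after `n` steps: action `a` is drawn from the
decision of the scheduler; then the sojourn time is exponentially distributed with the exit rate of
`(l, a)` and, independently, the successor is drawn from the transition probabilities. Hence
`(a, l')` carries the density `S(l, n)(a) * R(l, a, l') * exp (-R(l, a, L) * τ)` in the sojourn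
time `τ ≥ 0`. -/
noncomputable def CRScheduler.stepMeasure {M : CTMDP L A} (S : M.CRScheduler) (n : ℕ) (l : L) :
    Measure (Step L A) :=
  ∑ a, S.decision l n a •
    (Measure.dirac a).prod ((expMeasure (M.exitRate l a : ℝ)).prod
      (∑ l', ((M.transProb l a l' : ℝ≥0) : ℝ≥0∞) • Measure.dirac l'))

instance {M : CTMDP L A} (S : M.CRScheduler) (n : ℕ) (l : L) :
    IsProbabilityMeasure (S.stepMeasure n l) := by
  constructor
  have key : ∀ a, (S.decision l n a •
      (Measure.dirac a).prod ((expMeasure (M.exitRate l a : ℝ)).prod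
        (∑ l', ((M.transProb l a l' : ℝ≥0) : ℝ≥0∞) • Measure.dirac l'))) Set.univ
      = S.decision l n a := by
    intro a
    by_cases ha : S.decision l n a = 0
    · simp [ha]
    · have hen : 0 < M.exitRate l a := S.enabled l n a ((PMF.mem_support_iff _ _).2 ha)
      have hexp : IsProbabilityMeasure (expMeasure (M.exitRate l a : ℝ)) :=
        isProbabilityMeasure_expMeasure (by exact_mod_cast hen)
      have hsum : ∑ l', ((M.transProb l a l' : ℝ≥0) : ℝ≥0∞) = 1 := by
        have : ∑ l', M.transProb l a l' = 1 := by
          simp only [transProb, ← Finset.sum_div]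
          exact div_self hen.ne'
        exact_mod_cast congrArg (fun q : ℚ≥0 => (q : ℝ≥0)) this
      have hP : IsProbabilityMeasure
          (∑ l', ((M.transProb l a l' : ℝ≥0) : ℝ≥0∞) • Measure.dirac l' : Measure L) :=
        ⟨by simp [Measure.finsetSum_apply, hsum]⟩
      rw [Measure.smul_apply, measure_univ, smul_eq_mul, mul_one]
  rw [CRScheduler.stepMeasure, Measure.finsetSum_apply]
  simp_rw [key]
  rw [← tsum_fintype (L := .unconditional A)]
  exact (S.decision l n).tsum_coe

/-- The law of step number `n + 1` given steps `0, …, n`: it depends on the location entered by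
step `n` and on the number `n + 1` of steps taken so far. -/
noncomputable def CRScheduler.stepKernel {M : CTMDP L A} (S : M.CRScheduler) (n : ℕ) :
    Kernel (∀ _ : Finset.Iic n, Step L A) (Step L A) where
  toFun h := S.stepMeasure (n + 1) (h ⟨n, Finset.mem_Iic.2 le_rfl⟩).2.2
  measurable' := (measurable_of_countable (S.stepMeasure (n + 1))).comp (by fun_prop)

instance {M : CTMDP L A} (S : M.CRScheduler) (n : ℕ) : IsMarkovKernel (S.stepKernel n) :=
  ⟨fun h => inferInstanceAs (IsProbabilityMeasure
    (S.stepMeasure (n + 1) (h ⟨n, Finset.mem_Iic.2 le_rfl⟩).2.2))⟩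

/-- The probability measure on infinite timed paths that start in location `l`, induced by the
scheduler `S`. -/
noncomputable def CRScheduler.pathMeasure {M : CTMDP L A} (S : M.CRScheduler) (l : L) :
    Measure (ℕ → Step L A) :=
  Kernel.trajMeasure (X := fun _ => Step L A) (S.stepMeasure 0 l) S.stepKernel

end CTMDP

namespace CTMDP

variable {L A : Type*}

/-- The location after `n` steps of the path that starts in `l` and takes the steps `ω`. -/
def location (l : L) (ω : ℕ → Step L A) : ℕ → L
  | 0 => l
  | n + 1 => (ω n).2.2

/-- The time at which the location after `n` steps is entered. -/
def entryTime (ω : ℕ → Step L A) (n : ℕ) : ℝ := ∑ i ∈ Finset.range n, (ω i).2.1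

variable [Fintype L] [Fintype A]

/-- The paths that start in `l` and reach the goal region within time `t`. -/
def reachEvent (M : CTMDP L A) (l : L) (t : ℝ) : Set (ℕ → Step L A) :=
  {ω | ∃ n, location l ω n ∈ M.goal ∧ entryTime ω n ≤ t}

variable [MeasurableSpace L] [DiscreteMeasurableSpace L]
  [MeasurableSpace A] [DiscreteMeasurableSpace A]

/-- The probability of reaching the goal region within time `t` when starting in `l`. -/
noncomputable def CRScheduler.reachProbFrom {M : CTMDP L A} (S : M.CRScheduler) (l : L) (t : ℝ) :
    ℝ :=
  (S.pathMeasure l).real (M.reachEvent l t)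

/-- The time-bounded reachability probability under the initial distribution. -/
noncomputable def CRScheduler.reachProb {M : CTMDP L A} (S : M.CRScheduler) (t : ℝ) : ℝ :=
  ∑ l, (M.init l).toReal * S.reachProbFrom l t

/-- `S` is an optimal CR scheduler for time bound `t`. -/
def CRScheduler.IsOptimal {M : CTMDP L A} (S : M.CRScheduler) (t : ℝ) : Prop :=
  ∀ S' : M.CRScheduler, S'.reachProb t ≤ S.reachProb t

/-- `S` is an optimal CD scheduler for time bound `t`. -/
def CDScheduler.IsOptimal {M : CTMDP L A} (S : M.CDScheduler) (t : ℝ) : Prop :=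
  ∀ S' : M.CDScheduler, S'.toCR.reachProb t ≤ S.toCR.reachProb t

end CTMDP

set_option linter.unusedSectionVars false
namespace CTMDP

/-! The reachability probability is affine in each single decision: since decisions depend on the
step count, the entry at `(l₀, n₀)` is consulted at most once along a path. Hence the value of a
randomised scheduler is a convex combination of the values obtained by fixing an action there
(`reachProb_eq_sum_update`), and some enabled action does at least as well. Finitely many decisions
can thus be made deterministic without loss (`exists_deterministic_on`).

Decisions after many steps hardly matter: all exit rates are bounded, so a Chernoff bound makes the
probability of taking many steps within time `t` small, uniformly over schedulers
(`pathMeasure_entryTime_le`, `reachProb_le_add`). This reduces the comparison of CR with CD to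
finitely many decisions, up to ε. It also makes the value continuous on the compact product space of
CD schedulers, so a maximum exists. -/

/-! ### Laplace transform of the sojourn times -/

lemma lintegral_exp_neg_expMeasure {r : ℝ} (hr : 0 < r) :
    ∫⁻ τ, ENNReal.ofReal (Real.exp (-τ)) ∂(expMeasure r) = ENNReal.ofReal (r / (r + 1)) := by
  have hr1 : 0 < r + 1 := by linarith
  have hm : Measurable (fun τ : ℝ => ENNReal.ofReal (Real.exp (-τ))) := by fun_prop
  have hpdf : ∀ s : ℝ, Measurable (exponentialPDF s) := fun s =>
    (measurable_exponentialPDFReal s).ennreal_ofReal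
  have hd : expMeasure r = volume.withDensity (exponentialPDF r) := rfl
  rw [hd, lintegral_withDensity_eq_lintegral_mul _ (hpdf r) hm]
  have hmul : ∀ τ, (exponentialPDF r * fun τ : ℝ => ENNReal.ofReal (Real.exp (-τ))) τ
      = ENNReal.ofReal (r / (r + 1)) * exponentialPDF (r + 1) τ := by
    intro τ
    rw [Pi.mul_apply]
    rcases lt_or_ge τ 0 with h | h
    · rw [exponentialPDF_of_neg h, exponentialPDF_of_neg h, zero_mul, mul_zero]
    · rw [exponentialPDF_of_nonneg h, exponentialPDF_of_nonneg h,
        ← ENNReal.ofReal_mul (by positivity), ← ENNReal.ofReal_mul (by positivity)]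
      congr 1
      have : Real.exp (-((r + 1) * τ)) = Real.exp (-(r * τ)) * Real.exp (-τ) := by
        rw [← Real.exp_add]
        ring_nf
      rw [this]
      field_simp
  simp_rw [hmul]
  rw [lintegral_const_mul _ (hpdf _), lintegral_exponentialPDF_eq_one hr1, mul_one]

variable {L A : Type*} [Fintype L] [Fintype A]

/-- The sum of all exit rates. -/
noncomputable def totalRate (M : CTMDP L A) : ℝ := ∑ l, ∑ a, (M.exitRate l a : ℝ)

lemma exitRate_le_totalRate (M : CTMDP L A) (l : L) (a : A) :
    (M.exitRate l a : ℝ) ≤ M.totalRate := by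
  have h1 : (M.exitRate l a : ℝ) ≤ ∑ a, (M.exitRate l a : ℝ) :=
    Finset.single_le_sum (f := fun a => (M.exitRate l a : ℝ))
      (fun _ _ => by positivity) (Finset.mem_univ a)
  exact h1.trans (Finset.single_le_sum (f := fun l => ∑ a, (M.exitRate l a : ℝ))
    (fun _ _ => Finset.sum_nonneg fun _ _ => by positivity) (Finset.mem_univ l))

lemma totalRate_nonneg (M : CTMDP L A) : 0 ≤ M.totalRate :=
  Finset.sum_nonneg fun _ _ => Finset.sum_nonneg fun _ _ => by positivity

/-- A bound on the Laplace transform at `1` of every sojourn time. -/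
noncomputable def sojournBound (M : CTMDP L A) : ℝ≥0∞ :=
  ENNReal.ofReal (M.totalRate / (M.totalRate + 1))

lemma sojournBound_lt_one (M : CTMDP L A) : M.sojournBound < 1 := by
  have := M.totalRate_nonneg
  rw [sojournBound, ENNReal.ofReal_lt_one, div_lt_one (by linarith)]
  linarith

lemma sum_transProb (M : CTMDP L A) {l : L} {a : A} (h : a ∈ M.enabled l) :
    ∑ l', ((M.transProb l a l' : ℝ≥0) : ℝ≥0∞) = 1 := by
  have h' : 0 < M.exitRate l a := h
  have : ∑ l', M.transProb l a l' = 1 := by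
    simp only [transProb, ← Finset.sum_div]
    exact div_self h'.ne'
  exact_mod_cast congrArg (fun q : ℚ≥0 => (q : ℝ≥0)) this

variable [MeasurableSpace L] [DiscreteMeasurableSpace L]
  [MeasurableSpace A] [DiscreteMeasurableSpace A]

/-- The law of the step taken in location `l` under action `a`. -/
noncomputable def actionMeasure (M : CTMDP L A) (l : L) (a : A) : Measure (Step L A) :=
  (Measure.dirac a).prod ((expMeasure (M.exitRate l a : ℝ)).prod
    (∑ l', ((M.transProb l a l' : ℝ≥0) : ℝ≥0∞) • Measure.dirac l'))

lemma CRScheduler.stepMeasure_eq_sum {M : CTMDP L A} (S : M.CRScheduler) (n : ℕ) (l : L) :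
    S.stepMeasure n l = ∑ a, S.decision l n a • M.actionMeasure l a := rfl

lemma lintegral_exp_neg_actionMeasure_le (M : CTMDP L A) {l : L} {a : A} (h : a ∈ M.enabled l) :
    ∫⁻ x, ENNReal.ofReal (Real.exp (-x.2.1)) ∂(M.actionMeasure l a) ≤ M.sojournBound := by
  have hr : (0 : ℝ) < M.exitRate l a := by
    have : 0 < M.exitRate l a := h
    exact_mod_cast this
  have hexp : IsProbabilityMeasure (expMeasure (M.exitRate l a : ℝ)) :=
    isProbabilityMeasure_expMeasure hr
  have hP : IsProbabilityMeasure
      (∑ l', ((M.transProb l a l' : ℝ≥0) : ℝ≥0∞) • Measure.dirac l' : Measure L) :=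
    ⟨by simp [Measure.finsetSum_apply, M.sum_transProb h]⟩
  have hm1 : Measurable (fun x : Step L A => ENNReal.ofReal (Real.exp (-x.2.1))) := by fun_prop
  have hm2 : Measurable (fun x : ℝ × L => ENNReal.ofReal (Real.exp (-x.1))) := by fun_prop
  rw [actionMeasure, lintegral_prod _ hm1.aemeasurable]
  simp only [lintegral_const, measure_univ, mul_one]
  rw [lintegral_prod _ hm2.aemeasurable]
  simp only [lintegral_const, measure_univ, mul_one]
  rw [lintegral_exp_neg_expMeasure hr, sojournBound]
  -- The map r ↦ r / (r + 1) is increasing, so the total rate gives one bound for all locations and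
  -- actions.
  apply ENNReal.ofReal_le_ofReal
  have h1 := M.exitRate_le_totalRate l a
  rw [div_le_div_iff₀ (by linarith) (by linarith)]
  nlinarith

lemma CRScheduler.sum_decision {M : CTMDP L A} (S : M.CRScheduler) (l : L) (n : ℕ) :
    ∑ a, S.decision l n a = 1 := by
  rw [← tsum_fintype (L := .unconditional A)]
  exact (S.decision l n).tsum_coe

lemma CRScheduler.lintegral_exp_neg_stepMeasure_le {M : CTMDP L A} (S : M.CRScheduler)
    (n : ℕ) (l : L) :
    ∫⁻ x, ENNReal.ofReal (Real.exp (-x.2.1)) ∂(S.stepMeasure n l) ≤ M.sojournBound := by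
  rw [S.stepMeasure_eq_sum, lintegral_finsetSum_measure]
  calc _ ≤ ∑ a, S.decision l n a * M.sojournBound := by
        refine Finset.sum_le_sum fun a _ => ?_
        rw [lintegral_smul_measure, smul_eq_mul]
        by_cases ha : S.decision l n a = 0
        · simp [ha]
        · gcongr
          exact M.lintegral_exp_neg_actionMeasure_le
            (S.enabled l n a ((PMF.mem_support_iff _ _).2 ha))
    _ = M.sojournBound := by rw [← Finset.sum_mul, S.sum_decision, one_mul]

/-! ### Laws of finite prefixes and the tail of the step count -/

namespace CRScheduler

/-- Steps `0, …, n + 1` assembled from steps `0, …, n` and step `n + 1`. -/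
def snocStep (n : ℕ) (p : (∀ _ : Finset.Iic n, Step L A) × Step L A) :
    ∀ _ : Finset.Iic (n + 1), Step L A :=
  fun i => if h : i.1 ≤ n then p.1 ⟨i.1, Finset.mem_Iic.2 h⟩ else p.2

lemma measurable_snocStep (n : ℕ) : Measurable (snocStep (L := L) (A := A) n) := by
  refine measurable_pi_lambda _ fun i => ?_
  unfold snocStep
  split_ifs with h
  · fun_prop
  · fun_prop

variable {M : CTMDP L A}

instance (S : M.CRScheduler) (l : L) : IsProbabilityMeasure (S.pathMeasure l) := by
  unfold pathMeasure
  infer_instance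

/-- The law of steps `0, …, n`. -/
noncomputable def prefixMeasure (S : M.CRScheduler) (l : L) (n : ℕ) :
    Measure (∀ _ : Finset.Iic n, Step L A) :=
  (S.pathMeasure l).map (Preorder.frestrictLe (π := fun _ : ℕ => Step L A) n)

instance (S : M.CRScheduler) (l : L) (n : ℕ) : IsProbabilityMeasure (S.prefixMeasure l n) :=
  Measure.isProbabilityMeasure_map (by fun_prop)

lemma prefixMeasure_compProd (S : M.CRScheduler) (l : L) (n : ℕ) :
    S.prefixMeasure l n ⊗ₘ S.stepKernel n = (S.pathMeasure l).map
      (fun ω => (Preorder.frestrictLe (π := fun _ : ℕ => Step L A) n ω, ω (n + 1))) :=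
  Kernel.map_frestrictLe_trajMeasure_compProd_eq_map_trajMeasure

/-- The recursion behind the inductions that compare prefix laws of different schedulers. -/
lemma prefixMeasure_succ (S : M.CRScheduler) (l : L) (n : ℕ) :
    S.prefixMeasure l (n + 1) = (S.prefixMeasure l n ⊗ₘ S.stepKernel n).map (snocStep n) := by
  rw [prefixMeasure_compProd, Measure.map_map (measurable_snocStep n) (by fun_prop), prefixMeasure]
  congr 1
  funext ω i
  have hi := Finset.mem_Iic.1 i.2
  simp only [Function.comp, snocStep, Preorder.frestrictLe_apply]
  split_ifs with h
  · rfl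
  · have : i.1 = n + 1 := by omega
    rw [this]

lemma prefixMeasure_zero (S : M.CRScheduler) (l : L) :
    S.prefixMeasure l 0 = (S.stepMeasure 0 l).map
      (MeasurableEquiv.piUnique (fun _ : Finset.Iic 0 => Step L A)).symm := by
  rw [prefixMeasure, pathMeasure, Kernel.trajMeasure, Measure.map_comp _ _ (by fun_prop),
    Kernel.traj_map_frestrictLe, Kernel.partialTraj_self, Measure.id_comp]

lemma pathMeasure_map_zero (S : M.CRScheduler) (l : L) :
    (S.pathMeasure l).map (fun ω => ω 0) = S.stepMeasure 0 l := by
  have h : (fun ω : ℕ → Step L A => ω 0) =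
      (MeasurableEquiv.piUnique (fun _ : Finset.Iic 0 => Step L A)) ∘
        Preorder.frestrictLe (π := fun _ : ℕ => Step L A) 0 := by
    funext ω
    rfl
  rw [h, ← Measure.map_map (by fun_prop) (by fun_prop), ← prefixMeasure, prefixMeasure_zero,
    Measure.map_map (by fun_prop) (by fun_prop), MeasurableEquiv.self_comp_symm, Measure.map_id]

/-- Sojourn times need not be independent, but conditionally on the past each new one contributes a
factor of at most `sojournBound`. -/
lemma lintegral_exp_neg_entryTime_le (S : M.CRScheduler) (l : L) (n : ℕ) :
    ∫⁻ ω, ENNReal.ofReal (Real.exp (-entryTime ω n)) ∂(S.pathMeasure l)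
      ≤ M.sojournBound ^ n := by
  -- A prefix over `Iic n` holds `n + 1` steps, so the induction runs over entry times of index `n +
  -- 1`, and index 0 is treated apart.
  rcases n with _ | n
  · simp [entryTime]
  induction n with
  | zero =>
    have hm : Measurable (fun x : Step L A => ENNReal.ofReal (Real.exp (-x.2.1))) := by fun_prop
    have := S.lintegral_exp_neg_stepMeasure_le 0 l
    rw [← pathMeasure_map_zero, lintegral_map hm (by fun_prop)] at this
    simpa [entryTime] using this
  | succ n ih =>
    let f : (∀ _ : Finset.Iic n, Step L A) → ℝ≥0∞ := fun h =>
      ENNReal.ofReal (Real.exp (-∑ i : Fin (n + 1),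
        (h ⟨i.1, Finset.mem_Iic.2 (Nat.lt_succ_iff.1 i.2)⟩).2.1))
    have hf : Measurable f := by fun_prop
    have hg : Measurable (fun x : Step L A => ENNReal.ofReal (Real.exp (-x.2.1))) := by fun_prop
    have hfeq : ∀ ω : ℕ → Step L A,
        f (Preorder.frestrictLe (π := fun _ : ℕ => Step L A) n ω)
          = ENNReal.ofReal (Real.exp (-entryTime ω (n + 1))) := by
      intro ω
      simp only [f, entryTime, Preorder.frestrictLe_apply, Finset.sum_range]
    calc ∫⁻ ω, ENNReal.ofReal (Real.exp (-entryTime ω (n + 1 + 1))) ∂(S.pathMeasure l)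
        = ∫⁻ ω, (fun p : (∀ _ : Finset.Iic n, Step L A) × Step L A =>
            f p.1 * ENNReal.ofReal (Real.exp (-p.2.2.1)))
            (Preorder.frestrictLe (π := fun _ : ℕ => Step L A) n ω, ω (n + 1))
            ∂(S.pathMeasure l) := by
          refine lintegral_congr fun ω => ?_
          simp only [hfeq]
          rw [← ENNReal.ofReal_mul (by positivity), ← Real.exp_add, entryTime,
            Finset.sum_range_succ, neg_add, entryTime]
      _ = ∫⁻ p, f p.1 * ENNReal.ofReal (Real.exp (-p.2.2.1))
            ∂(S.prefixMeasure l n ⊗ₘ S.stepKernel n) := by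
          rw [prefixMeasure_compProd, lintegral_map (by fun_prop) (by fun_prop)]
      _ = ∫⁻ h, f h * ∫⁻ x, ENNReal.ofReal (Real.exp (-x.2.1)) ∂(S.stepKernel n h)
            ∂(S.prefixMeasure l n) := by
          rw [Measure.lintegral_compProd (by fun_prop)]
          refine lintegral_congr fun h => ?_
          exact lintegral_const_mul (f h) hg
      _ ≤ ∫⁻ h, f h * M.sojournBound ∂(S.prefixMeasure l n) := by
          refine lintegral_mono fun h => ?_
          gcongr
          exact S.lintegral_exp_neg_stepMeasure_le _ _
      _ ≤ M.sojournBound ^ (n + 1) * M.sojournBound := by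
          rw [lintegral_mul_const _ hf, prefixMeasure, lintegral_map hf (by fun_prop)]
          simp_rw [hfeq]
          gcongr
      _ = M.sojournBound ^ (n + 1 + 1) := by rw [← pow_succ]

/-- Chernoff bound: on this event `exp (t - entryTime ω n)` is at least 1. -/
lemma pathMeasure_entryTime_le (S : M.CRScheduler) (l : L) (t : ℝ) (n : ℕ) :
    S.pathMeasure l {ω | entryTime ω n ≤ t} ≤
      ENNReal.ofReal (Real.exp t) * M.sojournBound ^ n := by
  have hm : Measurable (fun ω : ℕ → Step L A => entryTime ω n) := by
    unfold entryTime
    fun_prop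
  have hs : MeasurableSet {ω : ℕ → Step L A | entryTime ω n ≤ t} := hm measurableSet_Iic
  calc S.pathMeasure l {ω | entryTime ω n ≤ t}
      = ∫⁻ ω in {ω | entryTime ω n ≤ t}, 1 ∂(S.pathMeasure l) := by simp
    _ ≤ ∫⁻ ω in {ω | entryTime ω n ≤ t},
          ENNReal.ofReal (Real.exp t) * ENNReal.ofReal (Real.exp (-entryTime ω n))
          ∂(S.pathMeasure l) := by
        refine setLIntegral_mono (by fun_prop) fun ω hω => ?_
        rw [← ENNReal.ofReal_mul (by positivity), ← Real.exp_add, ENNReal.one_le_ofReal,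
          Real.one_le_exp_iff]
        have : entryTime ω n ≤ t := hω
        linarith
    _ ≤ ∫⁻ ω, ENNReal.ofReal (Real.exp t) * ENNReal.ofReal (Real.exp (-entryTime ω n))
          ∂(S.pathMeasure l) := setLIntegral_le_lintegral _ _
    _ = ENNReal.ofReal (Real.exp t) *
          ∫⁻ ω, ENNReal.ofReal (Real.exp (-entryTime ω n)) ∂(S.pathMeasure l) :=
        lintegral_const_mul _ (by fun_prop)
    _ ≤ _ := by
        gcongr
        exact S.lintegral_exp_neg_entryTime_le l n

/-- Steps `0, …, n` consult only decisions with step counts `0, …, n`. -/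
lemma prefixMeasure_congr {S T : M.CRScheduler} (l : L) {n : ℕ}
    (h : ∀ l', ∀ m ≤ n, S.decision l' m = T.decision l' m) :
    S.prefixMeasure l n = T.prefixMeasure l n := by
  induction n with
  | zero => rw [prefixMeasure_zero, prefixMeasure_zero, stepMeasure_eq_sum, stepMeasure_eq_sum,
      h l 0 le_rfl]
  | succ n ih =>
    have hk : S.stepKernel n = T.stepKernel n := by
      ext1 x
      change S.stepMeasure (n + 1) _ = T.stepMeasure (n + 1) _
      rw [stepMeasure_eq_sum, stepMeasure_eq_sum, h _ _ le_rfl]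
    rw [prefixMeasure_succ, prefixMeasure_succ, hk, ih fun l' m hm => h l' m (by omega)]

end CRScheduler
end CTMDP

/-! ### Affine dependence on a single decision -/

namespace CTMDP

variable {L A : Type*} [Fintype L] [Fintype A]

namespace CRScheduler

variable {M : CTMDP L A}

open Classical in
/-- The scheduler that takes action `a` in location `l₀` after `n₀` steps, if `a` is enabled there,
and agrees with `S` otherwise. -/
noncomputable def update (S : M.CRScheduler) (l₀ : L) (n₀ : ℕ) (a : A) : M.CRScheduler where
  decision l n := if (l = l₀ ∧ n = n₀) ∧ a ∈ M.enabled l₀ then PMF.pure a else S.decision l n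
  enabled l n b hb := by
    split_ifs at hb with h
    · rw [PMF.mem_support_pure_iff] at hb
      rw [hb, h.1.1]
      exact h.2
    · exact S.enabled l n b hb

lemma update_decision_of_ne (S : M.CRScheduler) {l₀ : L} {n₀ : ℕ} (a : A) {l : L} {n : ℕ}
    (h : ¬ (l = l₀ ∧ n = n₀)) : (S.update l₀ n₀ a).decision l n = S.decision l n :=
  if_neg fun h' => h h'.1

lemma update_decision_self (S : M.CRScheduler) {l₀ : L} (n₀ : ℕ) {a : A}
    (h : a ∈ M.enabled l₀) : (S.update l₀ n₀ a).decision l₀ n₀ = PMF.pure a :=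
  if_pos ⟨⟨rfl, rfl⟩, h⟩

variable [MeasurableSpace L] [DiscreteMeasurableSpace L]
  [MeasurableSpace A] [DiscreteMeasurableSpace A]

/-- Away from `(l₀, n₀)` all summands share one law and the weights sum to 1. At `(l₀, n₀)` disabled
actions have weight 0, so the fallback in `update` plays no role. -/
lemma stepMeasure_eq_sum_update (S : M.CRScheduler) (l₀ : L) (n₀ n : ℕ) (l : L) :
    S.stepMeasure n l =
      ∑ a, S.decision l₀ n₀ a • (S.update l₀ n₀ a).stepMeasure n l := by
  classical
  by_cases h : l = l₀ ∧ n = n₀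
  · obtain ⟨rfl, rfl⟩ := h
    rw [stepMeasure_eq_sum]
    refine Finset.sum_congr rfl fun a _ => ?_
    by_cases ha : S.decision l n a = 0
    · simp [ha]
    · rw [stepMeasure_eq_sum, S.update_decision_self n
        (S.enabled l n a ((PMF.mem_support_iff _ _).2 ha))]
      simp [PMF.pure_apply]
  · have : ∀ a, (S.update l₀ n₀ a).stepMeasure n l = S.stepMeasure n l := fun a => by
      rw [stepMeasure_eq_sum, stepMeasure_eq_sum, S.update_decision_of_ne a h]
    simp_rw [this]
    rw [← Finset.sum_smul, S.sum_decision, one_smul]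

lemma stepKernel_update_of_ne (S : M.CRScheduler) (l₀ : L) {n₀ n : ℕ} (a : A) (h : n + 1 ≠ n₀) :
    (S.update l₀ n₀ a).stepKernel n = S.stepKernel n := by
  ext1 x
  change (S.update l₀ n₀ a).stepMeasure (n + 1) _ = S.stepMeasure (n + 1) _
  rw [stepMeasure_eq_sum, stepMeasure_eq_sum, S.update_decision_of_ne a fun h' => h h'.2]

lemma prefixMeasure_eq_sum_update (S : M.CRScheduler) (l₀ : L) (n₀ : ℕ) (l : L) (n : ℕ) :
    S.prefixMeasure l n =
      ∑ a, S.decision l₀ n₀ a • (S.update l₀ n₀ a).prefixMeasure l n := by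
  induction n with
  | zero =>
    ext s hs
    have he : Measurable
      (MeasurableEquiv.piUnique (fun _ : Finset.Iic 0 => Step L A)).symm := by fun_prop
    rw [prefixMeasure_zero, Measure.map_apply he hs, S.stepMeasure_eq_sum_update l₀ n₀,
      Measure.finsetSum_apply, Measure.finsetSum_apply]
    refine Finset.sum_congr rfl fun a _ => ?_
    rw [Measure.smul_apply, Measure.smul_apply, prefixMeasure_zero, Measure.map_apply he hs]
  | succ n ih =>
    ext s hs
    have hs' := measurable_snocStep (L := L) (A := A) n hs
    rw [Measure.finsetSum_apply]
    simp_rw [Measure.smul_apply, prefixMeasure_succ, Measure.map_apply (measurable_snocStep n) hs,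
      Measure.compProd_apply hs', smul_eq_mul]
    -- At step `n₀` the prefix law is common to all updated schedulers and only the kernel splits;
    -- at any other step the kernel is common and only the prefix law may split. The two never vary
    -- together, so no cross terms arise.
    by_cases h : n + 1 = n₀
    · have hQ : ∀ a, (S.update l₀ n₀ a).prefixMeasure l n = S.prefixMeasure l n := fun a =>
        prefixMeasure_congr l fun l' m hm => S.update_decision_of_ne a (by omega)
      simp_rw [hQ]
      simp_rw [← lintegral_const_mul _ (Kernel.measurable_kernel_prodMk_left hs')]
      rw [← lintegral_finsetSum _
        fun a _ => (Kernel.measurable_kernel_prodMk_left hs').const_mul _]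
      refine lintegral_congr fun x => ?_
      change S.stepMeasure (n + 1) _ _ =
        ∑ a, _ * (S.update l₀ n₀ a).stepMeasure (n + 1) _ _
      rw [S.stepMeasure_eq_sum_update l₀ n₀, Measure.finsetSum_apply]
      rfl
    · simp_rw [S.stepKernel_update_of_ne l₀ _ h]
      rw [ih, lintegral_finsetSum_measure]
      simp_rw [lintegral_smul_measure, smul_eq_mul]

/-- A measure on paths with finite marginals is determined by its prefix laws, as the projective
limit of its marginals. -/
lemma pathMeasure_eq_sum_update (S : M.CRScheduler) (l₀ : L) (n₀ : ℕ) (l : L) :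
    S.pathMeasure l = ∑ a, S.decision l₀ n₀ a • (S.update l₀ n₀ a).pathMeasure l := by
  let P : ∀ I : Finset ℕ, Measure (∀ _ : I, Step L A) := fun I => (S.pathMeasure l).map I.restrict
  have hS : IsProjectiveLimit (α := fun _ : ℕ => Step L A) (S.pathMeasure l) P := fun I => rfl
  have hP : IsProjectiveMeasureFamily (α := fun _ : ℕ => Step L A) P := by
    intro I J hJI
    exact (Measure.map_map (Finset.measurable_restrict₂ hJI) (Finset.measurable_restrict I)).symm
  have : ∀ I, IsFiniteMeasure (P I) := fun I => by
    change IsFiniteMeasure ((S.pathMeasure l).map _)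
    infer_instance
  refine hS.unique ((isProjectiveLimit_nat_iff hP _).2 fun n => ?_)
  change _ = S.prefixMeasure l n
  rw [S.prefixMeasure_eq_sum_update l₀ n₀]
  ext s hs
  have hr : Measurable (Preorder.frestrictLe (π := fun _ : ℕ => Step L A) n) := by fun_prop
  rw [Measure.map_apply hr hs, Measure.finsetSum_apply, Measure.finsetSum_apply]
  refine Finset.sum_congr rfl fun a _ => ?_
  rw [Measure.smul_apply, Measure.smul_apply, prefixMeasure, Measure.map_apply hr hs]

lemma reachProb_eq_sum_update (S : M.CRScheduler) (l₀ : L) (n₀ : ℕ) (t : ℝ) :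
    S.reachProb t = ∑ a, (S.decision l₀ n₀ a).toReal * (S.update l₀ n₀ a).reachProb t := by
  have h : ∀ l, S.reachProbFrom l t =
      ∑ a, (S.decision l₀ n₀ a).toReal * (S.update l₀ n₀ a).reachProbFrom l t := by
    intro l
    unfold reachProbFrom
    rw [measureReal_def, S.pathMeasure_eq_sum_update l₀ n₀, Measure.finsetSum_apply,
      ENNReal.toReal_sum fun a _ => ?_]
    · simp_rw [Measure.smul_apply, smul_eq_mul, ENNReal.toReal_mul]
      rfl
    · exact ENNReal.mul_ne_top (PMF.apply_ne_top _ _) (measure_ne_top _ _)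
  unfold reachProb
  simp_rw [h, Finset.mul_sum]
  rw [Finset.sum_comm]
  refine Finset.sum_congr rfl fun a _ => Finset.sum_congr rfl fun l _ => ?_
  ring

/-- A weighted average cannot exceed every value in its support, and the support consists of enabled
actions. -/
lemma exists_reachProb_le_update (S : M.CRScheduler) (l₀ : L) (n₀ : ℕ) (t : ℝ) :
    ∃ a ∈ M.enabled l₀, S.reachProb t ≤ (S.update l₀ n₀ a).reachProb t := by
  by_contra! hlt
  have hsum : ∑ a, (S.decision l₀ n₀ a).toReal = 1 := by
    rw [← ENNReal.toReal_sum fun a _ => PMF.apply_ne_top _ _, S.sum_decision, ENNReal.toReal_one]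
  have hen : ∀ a, S.decision l₀ n₀ a ≠ 0 → a ∈ M.enabled l₀ := fun a ha =>
    S.enabled l₀ n₀ a ((PMF.mem_support_iff _ _).2 ha)
  obtain ⟨b, hb⟩ := (S.decision l₀ n₀).support_nonempty
  have hb0 := (PMF.mem_support_iff _ _).1 hb
  have : S.reachProb t < ∑ a, (S.decision l₀ n₀ a).toReal * S.reachProb t := by
    conv_lhs => rw [S.reachProb_eq_sum_update l₀ n₀ t]
    refine Finset.sum_lt_sum (fun a _ => ?_) ⟨b, Finset.mem_univ b, ?_⟩
    · by_cases ha : S.decision l₀ n₀ a = 0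
      · simp [ha]
      · exact mul_le_mul_of_nonneg_left (hlt a (hen a ha)).le ENNReal.toReal_nonneg
    · exact mul_lt_mul_of_pos_left (hlt b (hen b hb0))
        (ENNReal.toReal_pos hb0 (PMF.apply_ne_top _ _))
  rw [← Finset.sum_mul, hsum, one_mul] at this
  exact lt_irrefl _ this

/-- Randomised decisions at finitely many arguments can be made deterministic without decreasing
the reachability probability. -/
lemma exists_deterministic_on (S : M.CRScheduler) (t : ℝ) (s : Finset (L × ℕ)) :
    ∃ S' : M.CRScheduler, S.reachProb t ≤ S'.reachProb t ∧
      ∀ p ∈ s, ∃ a ∈ M.enabled p.1, S'.decision p.1 p.2 = PMF.pure a := by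
  classical
  induction s using Finset.induction_on with
  | empty => exact ⟨S, le_rfl, by simp⟩
  | insert p s _ ih =>
    obtain ⟨S₁, hle, hdet⟩ := ih
    obtain ⟨a, ha, hle'⟩ := S₁.exists_reachProb_le_update p.1 p.2 t
    refine ⟨S₁.update p.1 p.2 a, hle.trans hle', fun r hr => ?_⟩
    by_cases hrp : r.1 = p.1 ∧ r.2 = p.2
    · rw [hrp.1, hrp.2]
      exact ⟨a, ha, S₁.update_decision_self p.2 ha⟩
    · rw [S₁.update_decision_of_ne a hrp]
      rcases Finset.mem_insert.1 hr with rfl | hr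
      · exact absurd ⟨rfl, rfl⟩ hrp
      · exact hdet r hr

end CRScheduler

/-! ### Truncation after finitely many steps -/

/-- The paths that start in `l` and are in the goal region at a time at most `t` within the first
`n` steps. -/
def reachEventWithin (M : CTMDP L A) (l : L) (t : ℝ) (n : ℕ) : Set (ℕ → Step L A) :=
  {ω | ∃ m ≤ n, location l ω m ∈ M.goal ∧ entryTime ω m ≤ t}

/-- A bound on the probability of taking more than `n` steps within time `t`. -/
noncomputable def tailBound (M : CTMDP L A) (t : ℝ) (n : ℕ) : ℝ≥0∞ :=
  ∑' k, ENNReal.ofReal (Real.exp t) * M.sojournBound ^ (k + n)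

lemma tendsto_tailBound (M : CTMDP L A) (t : ℝ) :
    Filter.Tendsto (M.tailBound t) Filter.atTop (nhds 0) := by
  refine ENNReal.tendsto_sum_nat_add
    (fun k => ENNReal.ofReal (Real.exp t) * M.sojournBound ^ k) ?_
  rw [ENNReal.tsum_mul_left, ENNReal.tsum_geometric]
  refine ENNReal.mul_ne_top ENNReal.ofReal_ne_top (ENNReal.inv_ne_top.2 ?_)
  exact (tsub_pos_of_lt M.sojournBound_lt_one).ne'

/-- The offset 2 arises because decisions with counts `0, …, n` determine the law of the locations
and entry times up to index `n + 1`; the uncontrolled part starts at index `n + 2`. -/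
lemma exists_tailBound_le (M : CTMDP L A) (t : ℝ) {ε : ℝ} (hε : 0 < ε) :
    ∃ n, M.tailBound t (n + 2) ≤ ENNReal.ofReal ε := by
  have h := ((M.tendsto_tailBound t).comp (Filter.tendsto_add_atTop_nat 2)).eventually
    (Iic_mem_nhds (ENNReal.ofReal_pos.2 hε))
  exact h.exists

variable [MeasurableSpace L] [DiscreteMeasurableSpace L]
  [MeasurableSpace A] [DiscreteMeasurableSpace A]

namespace CRScheduler

variable {M : CTMDP L A}

lemma pathMeasure_reachEventWithin_congr {S T : M.CRScheduler} (l : L) (t : ℝ) {n : ℕ}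
    (h : ∀ l', ∀ m ≤ n, S.decision l' m = T.decision l' m) :
    S.pathMeasure l (M.reachEventWithin l t (n + 1)) =
      T.pathMeasure l (M.reachEventWithin l t (n + 1)) := by
  let r := Preorder.frestrictLe (π := fun _ : ℕ => Step L A) n
  have hr : Measurable r := by fun_prop
  let loc : (∀ _ : Finset.Iic n, Step L A) → Fin (n + 2) → L := fun x m =>
    Fin.cases l (fun k => (x ⟨k.1, Finset.mem_Iic.2 (Nat.lt_succ_iff.1 k.2)⟩).2.2) m
  let time : (∀ _ : Finset.Iic n, Step L A) → Fin (n + 2) → ℝ := fun x m =>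
    ∑ k : Fin m.1, (x ⟨k.1, Finset.mem_Iic.2 (by omega)⟩).2.1
  have hloc : ∀ m, Measurable fun x => loc x m := by
    intro m
    refine Fin.cases ?_ (fun k => ?_) m
    · exact measurable_const
    · change Measurable fun x : (∀ _ : Finset.Iic n, Step L A) =>
        (x ⟨k.1, Finset.mem_Iic.2 (Nat.lt_succ_iff.1 k.2)⟩).2.2
      fun_prop
  have htime : ∀ m, Measurable fun x => time x m := fun m => by
    simp only [time]
    fun_prop
  let s : Set (∀ _ : Finset.Iic n, Step L A) := ⋃ m, {x | loc x m ∈ M.goal ∧ time x m ≤ t}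
  have hs : MeasurableSet s := MeasurableSet.iUnion fun m =>
    ((hloc m) (MeasurableSet.of_discrete (s := M.goal))).inter ((htime m) measurableSet_Iic)
  -- The truncated event is a measurable condition on steps `0, …, n`, so its probability depends
  -- only on the prefix law.
  have hrs : M.reachEventWithin l t (n + 1) = r ⁻¹' s := by
    ext ω
    have hl : ∀ m : Fin (n + 2), loc (r ω) m = location l ω m.1 := fun m => by
      refine Fin.cases rfl (fun k => rfl) m
    have ht : ∀ m : Fin (n + 2), time (r ω) m = entryTime ω m.1 := fun m => by
      simp only [time, entryTime, Finset.sum_range]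
      rfl
    simp only [reachEventWithin, Set.mem_ofPred_eq, Set.mem_preimage, s, Set.mem_iUnion, hl, ht]
    constructor
    · rintro ⟨m, hm, h⟩
      exact ⟨⟨m, by omega⟩, h⟩
    · rintro ⟨m, h⟩
      exact ⟨m.1, by omega, h⟩
  rw [hrs, ← Measure.map_apply hr hs, ← Measure.map_apply hr hs]
  exact congrArg (fun μ => μ s) (prefixMeasure_congr l h)

/-- The union bound over all later indices avoids monotonicity of entry times, which fails on paths
with negative sojourn coordinates. -/
lemma pathMeasure_reachEvent_le (S : M.CRScheduler) (l : L) (t : ℝ) (n : ℕ) :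
    S.pathMeasure l (M.reachEvent l t) ≤
      S.pathMeasure l (M.reachEventWithin l t n) + M.tailBound t (n + 1) := by
  have hsub : M.reachEvent l t ⊆
      M.reachEventWithin l t n ∪ ⋃ k, {ω | entryTime ω (k + (n + 1)) ≤ t} := by
    rintro ω ⟨m, hm, ht⟩
    rcases le_or_gt m n with h | h
    · exact Or.inl ⟨m, h, hm, ht⟩
    · refine Or.inr (Set.mem_iUnion.2 ⟨m - (n + 1), ?_⟩)
      rw [Set.mem_ofPred_eq, Nat.sub_add_cancel h]
      exact ht
  refine (measure_mono hsub).trans ((measure_union_le _ _).trans ?_)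
  gcongr
  exact (measure_iUnion_le _).trans
    (ENNReal.tsum_le_tsum fun k => S.pathMeasure_entryTime_le l t _)

lemma reachProbFrom_le_add {S T : M.CRScheduler} (l : L) (t : ℝ) {n : ℕ} {ε : ℝ} (hε : 0 ≤ ε)
    (hn : M.tailBound t (n + 2) ≤ ENNReal.ofReal ε)
    (h : ∀ l', ∀ m ≤ n, S.decision l' m = T.decision l' m) :
    S.reachProbFrom l t ≤ T.reachProbFrom l t + ε := by
  have key : S.pathMeasure l (M.reachEvent l t) ≤
      T.pathMeasure l (M.reachEvent l t) + ENNReal.ofReal ε := by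
    refine (S.pathMeasure_reachEvent_le l t (n + 1)).trans ?_
    rw [pathMeasure_reachEventWithin_congr l t h]
    refine add_le_add (measure_mono ?_) hn
    rintro ω ⟨m, -, hm⟩
    exact ⟨m, hm⟩
  have := ENNReal.toReal_mono (by finiteness) key
  rwa [ENNReal.toReal_add (by finiteness) (by finiteness), ENNReal.toReal_ofReal hε] at this

lemma reachProb_le_add {S T : M.CRScheduler} (t : ℝ) {n : ℕ} {ε : ℝ} (hε : 0 ≤ ε)
    (hn : M.tailBound t (n + 2) ≤ ENNReal.ofReal ε)
    (h : ∀ l', ∀ m ≤ n, S.decision l' m = T.decision l' m) :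
    S.reachProb t ≤ T.reachProb t + ε := by
  have hinit : ∑ l, (M.init l).toReal = 1 := by
    rw [← ENNReal.toReal_sum fun a _ => PMF.apply_ne_top _ _, ← tsum_fintype (L := .unconditional L),
      PMF.tsum_coe, ENNReal.toReal_one]
  calc S.reachProb t ≤ ∑ l, (M.init l).toReal * (T.reachProbFrom l t + ε) :=
        Finset.sum_le_sum fun l _ => mul_le_mul_of_nonneg_left
          (reachProbFrom_le_add l t hε hn h) ENNReal.toReal_nonneg
    _ = T.reachProb t + ε := by
        simp_rw [mul_add]
        rw [Finset.sum_add_distrib, ← Finset.sum_mul, hinit, one_mul]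
        rfl

end CRScheduler

/-! ### Compactness, existence of an optimum, and comparison of the classes -/

/-- A real function on sequences of choices from finite sets attains its maximum if it is determined
up to arbitrarily small errors by finite prefixes of the sequences. -/
lemma exists_forall_le_of_prefix_continuous {ι : Type*} [Finite ι] {E : ι → Type*}
    [∀ i, Finite (E i)] [∀ i, Nonempty (E i)] (F : (∀ i, ℕ → E i) → ℝ)
    (hF : ∀ ε > 0, ∃ n, ∀ x y, (∀ i, ∀ m ≤ n, x i m = y i m) → F x ≤ F y + ε) :
    ∃ x, ∀ y, F y ≤ F x := by
  -- With discrete finite factors the sequences form a compact product, in which agreement on a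
  -- finite prefix is an open condition; `hF` then gives continuity.
  let : ∀ i, TopologicalSpace (E i) := fun _ => ⊥
  have : ∀ i, DiscreteTopology (E i) := fun _ => ⟨rfl⟩
  have hcont : Continuous F := by
    refine continuous_iff_continuousAt.2 fun x => Metric.tendsto_nhds.2 fun ε hε => ?_
    obtain ⟨n, hn⟩ := hF (ε / 2) (half_pos hε)
    have hev : ∀ᶠ y in nhds x, ∀ i, ∀ m ∈ Finset.range (n + 1), y i m = x i m := by
      rw [Filter.eventually_all]
      intro i
      rw [Filter.eventually_all_finset]
      intro m _
      have hc : Continuous fun y : ∀ i, ℕ → E i => y i m := by fun_prop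
      exact ((isOpen_discrete {x i m}).preimage hc).mem_nhds rfl
    filter_upwards [hev] with y hy
    have hy' : ∀ i, ∀ m ≤ n, y i m = x i m := fun i m hm =>
      hy i m (Finset.mem_range.2 (by omega))
    have h1 := hn y x hy'
    have h2 := hn x y fun i m hm => (hy' i m hm).symm
    rw [Real.dist_eq, abs_lt]
    constructor <;> linarith
  obtain ⟨x, -, hx⟩ := isCompact_univ.exists_isMaxOn Set.univ_nonempty hcont.continuousOn
  exact ⟨x, fun y => hx (Set.mem_univ y)⟩

namespace CDScheduler

variable {M : CTMDP L A}

/-- CD schedulers are exactly the families of sequences of enabled actions, and the uniform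
truncation error supplies prefix continuity. -/
lemma exists_isOptimal (M : CTMDP L A) (t : ℝ) : ∃ S : M.CDScheduler, S.IsOptimal t := by
  have : ∀ l : L, Nonempty {a : A // a ∈ M.enabled l} := fun l =>
    let ⟨a, ha⟩ := M.exists_enabled l
    ⟨⟨a, ha⟩⟩
  let sched : (∀ l : L, ℕ → {a : A // a ∈ M.enabled l}) → M.CDScheduler := fun x =>
    ⟨fun l n => x l n, fun l n => (x l n).2⟩
  obtain ⟨x, hx⟩ := exists_forall_le_of_prefix_continuous
    (fun x => (sched x).toCR.reachProb t) fun ε hε => by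
      obtain ⟨n, hn⟩ := M.exists_tailBound_le t hε
      refine ⟨n, fun x y hxy => CRScheduler.reachProb_le_add t hε.le hn fun l m hm => ?_⟩
      change PMF.pure (x l m : A) = PMF.pure (y l m : A)
      rw [hxy l m hm]
  exact ⟨sched x, fun S' => hx fun l n => ⟨S'.decision l n, S'.enabled l n⟩⟩

lemma IsOptimal.toCR {S : M.CDScheduler} {t : ℝ} (hS : S.IsOptimal t) : S.toCR.IsOptimal t := by
  classical
  intro S'
  refine le_of_forall_pos_le_add fun ε hε => ?_
  obtain ⟨n, hn⟩ := M.exists_tailBound_le t hε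
  obtain ⟨T, hT, hdet⟩ := S'.exists_deterministic_on t (Finset.univ ×ˢ Finset.range (n + 1))
  choose f hf hfT using hdet
  choose g hg using M.exists_enabled
  -- `T` may still randomise after count `n`. There `D` plays an arbitrary enabled action, at a cost
  -- of at most `ε`.
  let D : M.CDScheduler :=
    { decision := fun l m => if h : (l, m) ∈ Finset.univ ×ˢ Finset.range (n + 1)
        then f (l, m) h else g l
      enabled := fun l m => by
        split_ifs with h
        · exact hf (l, m) h
        · exact hg l }
  have hD : ∀ l', ∀ m ≤ n, T.decision l' m = D.toCR.decision l' m := by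
    intro l' m hm
    have h : (l', m) ∈ Finset.univ ×ˢ Finset.range (n + 1) := by
      simp only [Finset.mem_product, Finset.mem_univ, Finset.mem_range, true_and]
      omega
    change _ = PMF.pure (dite _ _ _)
    rw [dif_pos h]
    exact hfT (l', m) h
  have h1 := CRScheduler.reachProb_le_add t hε.le hn hD
  have h2 := hS D
  linarith

end CDScheduler
end CTMDP

theorem mainTheorem3 {L A : Type*} [Fintype L] [Fintype A]
    [MeasurableSpace L] [DiscreteMeasurableSpace L]
    [MeasurableSpace A] [DiscreteMeasurableSpace A]
    (M : CTMDP L A) (t : ℝ) (ht : 0 ≤ t) :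
    (∀ S : M.CDScheduler, S.IsOptimal t → S.toCR.IsOptimal t) ∧
    ∃ p : ℝ,
      IsGreatest (Set.range fun S : M.CDScheduler => S.toCR.reachProb t) p ∧
      IsGreatest (Set.range fun S : M.CRScheduler => S.reachProb t) p := by
  refine ⟨fun S hS => hS.toCR, ?_⟩
  obtain ⟨S, hS⟩ := CTMDP.CDScheduler.exists_isOptimal M t
  refine ⟨S.toCR.reachProb t, ⟨⟨S, rfl⟩, ?_⟩, ⟨S.toCR, rfl⟩, ?_⟩
  · rintro _ ⟨S', rfl⟩
    exact hS S'
  · rintro _ ⟨S', rfl⟩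
    exact hS.toCR S'
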